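/- **Setting.** Let $\mathcal E$ be a finite biordered set, i.e. the set of idempotents of a semigroup $S$ (up to isomorphism) with the partial product $e\cdot f$ recorded exactly for the basic pairs, those with $\{ef,fe\}\cap\{e,f\}\neq\varnothing$; assume that this set is finite. Let $\mathsf{IG}(\mathcal E)=\langle\,\overline E \mid \bar e\bar f=\overline{e\cdot f}\ (\{e,f\}\text{ a basic pair})\,\rangle$ be the free idempotent generated semigroup over $\mathcal E$. Let $D_1,\dots,D_m$ ($m\ge 1$) be regular $\mathscr D$-classes of $\mathsf{IG}(\mathcal E)$, $D_k$ being the class of $\bar e_k$ with $e_k\in E$. Let $G_k=H_{\bar e_k}$ be the maximal subgroup. Let $I_k$ and $\Lambda_k$ enumerate the $\mathscr R$- and $\mathscr L$-classes of $D_k$. Choose representatives $r_i$ ($i\in I_k$) of the $\mathscr R$-classes inside the $\mathscr L$-class of $\bar e_k$, and $q_\lambda$ ($\lambda\in\Lambda_k$) of the $\mathscr L$-classes inside the $\mathscr R$-class of $\bar e_k$. Every element of $D_k$ is then written uniquely as a Rees matrix triple $(i,g,\lambda):=r_i\,g\,q_\lambda$ with $g\in G_k$. Let $\mathbf u,\mathbf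 v\in\mathsf{IG}(\mathcal E)$ have $\mathscr D$-fingerprint $(D_1,\dots,D_m)$, with decompositions $$\mathbf u=(i_1,a_1,\lambda_1)\cdots(i_m,a_m,\lambda_m),\qquad \mathbf v=(j_1,b_1,\mu_1)\cdots(j_m,b_m,\mu_m),$$ whose $k$-th factors lie in $D_k$ and which arise from minimal r-factorisations of words representing $\mathbf u$, $\mathbf v$ (every factor represents a regular element, and no product of two or more consecutive factors does). **Contact automaton.** $G^\partial$ denotes the dual (opposite) group of $G$. For $e\in E$ write $\sigma_e i=j$ with multiplier $g$ if $\bar e(i,h,\lambda)=(j,gh,\lambda)$ for all $h,\lambda$, and $\lambda\tau_e=\mu$ with multiplier $g$ if $(i,h,\lambda)\bar e=(i,hg,\mu)$ for all $i,h$. The contact automaton $\mathcal A(D_k,D_{k+1})$ has vertex set $\Lambda_k\times I_{k+1}$ and the following edges for each $e\in E$, labelled in $G_k\times G_{k+1}^\partial$. There is an edge $(\lambda,i)\to(\mu,j)$ labelled $(g_1^{-1},g_2)$ whenever $\mu\tau_e=\lambda$ with multiplier $g_1$ and $\sigma_e i=j$ with multiplier $g_2$. There is an edge $(\lambda,i)\to(\mu,j)$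 labelled $(g_1,g_2^{-1})$ whenever $\lambda\tau_e=\mu$ with multiplier $g_1$ and $\sigma_e j=i$ with multiplier $g_2$. The label of a walk is the product of its edge labels. For a vertex $p$, the vertex group $W_p\le G_k\times G_{k+1}^\partial$ is the group of labels of all closed walks based at $p$. **The map $\theta$.** For $A\subseteq G_1$ put $A_1=A$. For $1\le k<m$ put $A'_1=A_1$, and $A_k'=a_k^{-1}A_k^{-1}b_k$ if $k>1$, and let $$B_{k,k+1}=(A'_k\times G_{k+1})\cap W_{(\lambda_k,i_{k+1})}\,g_{k,k+1},$$ where $g_{k,k+1}$ is the label of a fixed walk from $(\lambda_k,i_{k+1})$ to $(\mu_k,j_{k+1})$ in $\mathcal A(D_k,D_{k+1})$ (and $B_{k,k+1}=\varnothing$ if there is no such walk). Let $A_{k+1}\subseteq G_{k+1}$ be the second projection of $B_{k,k+1}$. Finally $(A,\mathbf u,\mathbf v)\theta:=A_m\subseteq G_m$. **Group properties.** Let $G$ be a group, $H\le G$, and $\mathcal K$ a family of subgroups of $G$. $G$ has the $(H,\mathcal K)$-relative Howson property if $H\cap K$ is finitely generated for every finitely generated $K\in\mathcal K$. For the following two notions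 elements are represented by words over a finite generating set of $G$. $\mathsf{eRHP}(G,H,\mathcal K)$ says that $G$ has the $(H,\mathcal K)$-relative Howson property and there is an algorithm which, given a finite generating set of some $K\in\mathcal K$, computes a finite generating set of $H\cap K$. An algorithm solves $\mathsf{RCIP}(G,H,\mathcal K)$ if, given a finite generating set of some $K\in\mathcal K$ and $x,y\in G$, it decides whether $Hx\cap Ky=\varnothing$ and, if not, outputs an element of $Hx\cap Ky$. Let $\mathcal T_k$ be the class of tall subgroups of $G_k\times G_{k+1}^\partial$, i.e. those of the form $H\times G_{k+1}^\partial$ with $H\le G_k$ finitely generated. **Theorem.** Let $\mathcal E$, $\mathbf u$, $\mathbf v$ (with their decompositions) be as above. 1. For every subgroup $L\le G_1$ and every $x\in G_1$, the set $(Lx,\mathbf u,\mathbf v)\theta$ is either empty or a left coset $yM$ of a subgroup $M\le G_m$. 2. Suppose that for all $1\le k<m$ the group $G_k\times G_{k+1}^\partial$ has the $(W_{(\lambda_k,i_{k+1})},\mathcal T_k)$-relative Howson property. If $L\le G_1$ is finitely generated and $x\in G_1$, then either $(Lx,\mathbf u,\mathbf v)\theta=\varnothing$, or the subgroup $M$ of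 part 1 is finitely generated. 3. Suppose that for all $1\le k<m$ the property $\mathsf{eRHP}(G_k\times G_{k+1}^\partial,W_{(\lambda_k,i_{k+1})},\mathcal T_k)$ holds and there is an algorithm solving $\mathsf{RCIP}(G_k\times G_{k+1}^\partial,W_{(\lambda_k,i_{k+1})},\mathcal T_k)$. Then, for any finite generating sets of $G_1$ and $G_m$ (over which elements are represented as words), there is an algorithm which, given a finite generating set of a subgroup $L\le G_1$ and an element $x\in G_1$, decides whether $(Lx,\mathbf u,\mathbf v)\theta=\varnothing$ and, if not, outputs a finite generating set of $M$ and an element $y\in G_m$ such that $(Lx,\mathbf u,\mathbf v)\theta=yM$. -/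

import Mathlib

universe u

namespace FreeIG

/-! ### Green's relations and maximal subgroups -/

section Green

variable {S : Type u} [Semigroup S]

/-- The principal right ideal `a S¹`. -/
def rightIdeal (a : S) : Set S := {x | x = a ∨ ∃ s, x = a * s}

/-- The principal left ideal `S¹ a`. -/
def leftIdeal (a : S) : Set S := {x | x = a ∨ ∃ s, x = s * a}

/-- Green's relation `R`. -/
def GreenR (a b : S) : Prop := rightIdeal a = rightIdeal b

/-- Green's relation `L`. -/
def GreenL (a b : S) : Prop := leftIdeal a = leftIdeal b

/-- Green's relation `H`. -/
def GreenH (a b : S) : Prop := GreenR a b ∧ GreenL a b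

/-- Green's relation `D`, as the composition `R ∘ L` (which in every semigroup is the join of `R`
and `L`). -/
def GreenD (a b : S) : Prop := ∃ c, GreenR a c ∧ GreenL c b

/-- Regular elements of a semigroup. -/
def RegularElem (a : S) : Prop := ∃ b, a * b * a = a

theorem mem_rightIdeal_self (a : S) : a ∈ rightIdeal a := Or.inl rfl

theorem mem_leftIdeal_self (a : S) : a ∈ leftIdeal a := Or.inl rfl

theorem rightIdeal_le {a b : S} (h : a ∈ rightIdeal b) : rightIdeal a ⊆ rightIdeal b := by
  rintro x (rfl | ⟨s, rfl⟩)
  · exact h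
  · rcases h with rfl | ⟨t, rfl⟩
    · exact Or.inr ⟨s, rfl⟩
    · exact Or.inr ⟨t * s, mul_assoc _ _ _⟩

theorem leftIdeal_le {a b : S} (h : a ∈ leftIdeal b) : leftIdeal a ⊆ leftIdeal b := by
  rintro x (rfl | ⟨s, rfl⟩)
  · exact h
  · rcases h with rfl | ⟨t, rfl⟩
    · exact Or.inr ⟨s, rfl⟩
    · exact Or.inr ⟨s * t, (mul_assoc _ _ _).symm⟩

theorem greenR_iff {a b : S} : GreenR a b ↔ a ∈ rightIdeal b ∧ b ∈ rightIdeal a :=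
  ⟨fun h => ⟨h ▸ mem_rightIdeal_self a, h ▸ mem_rightIdeal_self b⟩,
    fun h => (rightIdeal_le h.1).antisymm (rightIdeal_le h.2)⟩

theorem greenL_iff {a b : S} : GreenL a b ↔ a ∈ leftIdeal b ∧ b ∈ leftIdeal a :=
  ⟨fun h => ⟨h ▸ mem_leftIdeal_self a, h ▸ mem_leftIdeal_self b⟩,
    fun h => (leftIdeal_le h.1).antisymm (leftIdeal_le h.2)⟩

/-- The `H`-class of an idempotent `e` consists of the invertible elements of `e S e`. -/
theorem greenH_idem_iff {e : S} (he : e * e = e) {x : S} :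
    GreenH e x ↔ e * x = x ∧ x * e = x ∧ ∃ y, e * y = y ∧ y * e = y ∧ x * y = e ∧ y * x = e := by
  constructor
  · rintro ⟨hR, hL⟩
    rw [greenR_iff] at hR
    rw [greenL_iff] at hL
    have h1 : e * x = x := by
      rcases hR.2 with rfl | ⟨s, rfl⟩
      · exact he
      · rw [← mul_assoc, he]
    have h2 : x * e = x := by
      rcases hL.2 with rfl | ⟨s, rfl⟩
      · exact he
      · rw [mul_assoc, he]
    obtain ⟨s, hs⟩ : ∃ s, x * s = e := by
      rcases hR.1 with h | ⟨s, h⟩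
      · exact ⟨e, by rw [h2, h]⟩
      · exact ⟨s, h.symm⟩
    obtain ⟨t, ht⟩ : ∃ t, t * x = e := by
      rcases hL.1 with h | ⟨s, h⟩
      · exact ⟨e, by rw [h1, h]⟩
      · exact ⟨s, h.symm⟩
    have hts : e * s = t * e := by
      rw [← ht, mul_assoc, hs, ht]
    refine ⟨h1, h2, e * s * e, ?_, ?_, ?_, ?_⟩
    · rw [← mul_assoc, ← mul_assoc, he]
    · rw [mul_assoc, he]
    · rw [← mul_assoc, ← mul_assoc, h2, hs, he]
    · rw [mul_assoc, h1, hts, mul_assoc, h1, ht]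
  · rintro ⟨h1, h2, y, -, -, h3, h4⟩
    exact ⟨greenR_iff.2 ⟨Or.inr ⟨y, h3.symm⟩, Or.inr ⟨x, h1.symm⟩⟩,
      greenL_iff.2 ⟨Or.inr ⟨y, h4.symm⟩, Or.inr ⟨x, h2.symm⟩⟩⟩

theorem GreenD.exists_greenL_greenR {e x : S} (h : GreenD e x) :
    ∃ y, GreenL e y ∧ GreenR y x := by
  obtain ⟨c, hR, hL⟩ := h
  obtain ⟨h1, h2⟩ := greenR_iff.1 hR
  obtain ⟨h3, h4⟩ := greenL_iff.1 hL
  rcases h1 with h1 | ⟨s, h1⟩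
  · exact ⟨x, h1 ▸ hL, rfl⟩
  rcases h2 with h2 | ⟨t, h2⟩
  · exact ⟨x, h2 ▸ hL, rfl⟩
  rcases h3 with h3 | ⟨v, h3⟩
  · exact ⟨e, rfl, h3 ▸ hR⟩
  rcases h4 with h4 | ⟨w, h4⟩
  · exact ⟨e, rfl, h4 ▸ hR⟩
  have hy : x * s = w * e := by rw [h4, mul_assoc, ← h1]
  refine ⟨x * s, greenL_iff.2 ⟨Or.inr ⟨v, ?_⟩, Or.inr ⟨w, hy⟩⟩,
    greenR_iff.2 ⟨Or.inr ⟨s, rfl⟩, Or.inr ⟨t, ?_⟩⟩⟩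
  · rw [← mul_assoc, ← h3, ← h1]
  · rw [hy, mul_assoc, ← h2, ← h4]

/-- The maximal subgroup with identity `e`: the `H`-class of the idempotent `e`. -/
def MaximalSubgroup (e : {e : S // e * e = e}) : Type u := {x : S // GreenH e.1 x}

theorem MaximalSubgroup.exists_inv (e : {e : S // e * e = e}) (x : MaximalSubgroup e) :
    ∃ y : MaximalSubgroup e, y.1 * x.1 = e.1 := by
  obtain ⟨h1, h2, y, h3, h4, h5, h6⟩ := (greenH_idem_iff e.2).1 x.2
  exact ⟨⟨y, (greenH_idem_iff e.2).2 ⟨h3, h4, x.1, h1, h2, h6, h5⟩⟩, h6⟩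

noncomputable instance (e : {e : S // e * e = e}) : Group (MaximalSubgroup e) :=
  letI : Mul (MaximalSubgroup e) := ⟨fun x y => ⟨x.1 * y.1, by
    obtain ⟨h1, h2, x', h3, h4, h5, h6⟩ := (greenH_idem_iff e.2).1 x.2
    obtain ⟨k1, k2, y', k3, k4, k5, k6⟩ := (greenH_idem_iff e.2).1 y.2
    refine (greenH_idem_iff e.2).2 ⟨?_, ?_, y' * x', ?_, ?_, ?_, ?_⟩
    · rw [← mul_assoc, h1]
    · rw [mul_assoc, k2]
    · rw [← mul_assoc, k3]
    · rw [mul_assoc, h4]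
    · rw [mul_assoc, ← mul_assoc y.1, k5, h3, h5]
    · rw [mul_assoc, ← mul_assoc x', h6, k1, k6]⟩⟩
  letI : One (MaximalSubgroup e) := ⟨⟨e.1, rfl, rfl⟩⟩
  letI : Inv (MaximalSubgroup e) := ⟨fun x => (MaximalSubgroup.exists_inv e x).choose⟩
  Group.ofLeftAxioms
    (fun x y z => Subtype.ext (mul_assoc x.1 y.1 z.1))
    (fun x => Subtype.ext ((greenH_idem_iff e.2).1 x.2).1)
    (fun x => Subtype.ext (MaximalSubgroup.exists_inv e x).choose_spec)

end Green

/-! ### Biordered sets and free idempotent generated semigroups -/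

/-- `{e, f}` is a basic pair: one of the products `e f`, `f e` is one of `e`, `f`. -/
def BasicPair {S : Type u} [Semigroup S] (e f : S) : Prop :=
  e * f = e ∨ e * f = f ∨ f * e = e ∨ f * e = f

/-- A biordered set on `E`: a partial multiplication on `E` which is, up to isomorphism, the
multiplication of basic pairs of idempotents of some semigroup. -/
structure BiorderedSet (E : Type u) where
  /-- The partial multiplication. -/
  pmul : E → E → Option E
  exists_semigroup : ∃ (S : Type u) (_ : Semigroup S) (φ : E → S),
    Function.Injective φ ∧ Set.range φ = {s : S | s * s = s} ∧
      ∀ e f g, pmul e f = some g ↔ BasicPair (φ e) (φ f) ∧ φ e * φ f = φ g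

section IG

variable {E : Type u} (B : BiorderedSet E)

/-- The defining relations `ē f̄ = \overline{e·f}`, for basic pairs `{e, f}`. -/
inductive IGRel : FreeSemigroup E → FreeSemigroup E → Prop
  | basic (e f g : E) (h : B.pmul e f = some g) :
      IGRel (FreeSemigroup.of e * FreeSemigroup.of f) (FreeSemigroup.of g)

/-- The free idempotent generated semigroup over the biordered set. -/
def IG : Type u := (conGen (IGRel B)).Quotient

instance : Semigroup (IG B) := inferInstanceAs (Semigroup (conGen (IGRel B)).Quotient)

/-- The element of the free idempotent generated semigroup represented by a (nonempty) word. -/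
def IG.mk (w : FreeSemigroup E) : IG B := Quotient.mk _ w

/-- The generator `ē`. -/
def IG.gen (e : E) : IG B := IG.mk B (FreeSemigroup.of e)

theorem IG.mk_mul (v w : FreeSemigroup E) : IG.mk B (v * w) = IG.mk B v * IG.mk B w := rfl

theorem IG.gen_mul_of_pmul {e f g : E} (h : B.pmul e f = some g) :
    IG.gen B e * IG.gen B f = IG.gen B g :=
  Quotient.sound (ConGen.Rel.of _ _ (IGRel.basic e f g h))

theorem IG.gen_idem (e : E) : IG.gen B e * IG.gen B e = IG.gen B e := by
  apply IG.gen_mul_of_pmul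
  obtain ⟨S, _, φ, -, hr, h⟩ := B.exists_semigroup
  have he : φ e * φ e = φ e := by
    have : φ e ∈ Set.range φ := ⟨e, rfl⟩
    rwa [hr] at this
  exact (h e e e).2 ⟨Or.inl he, he⟩

/-- The generator `ē` as an idempotent. -/
def IG.idem (e : E) : {x : IG B // x * x = x} := ⟨IG.gen B e, IG.gen_idem B e⟩

/-- A factorisation `w = w₁ ⋯ wₘ` of a word is a minimal r-factorisation if every factor represents
a regular element, and no product of two or more consecutive factors does. -/
def IsMinimalRFactorisation {m : ℕ} (w : Fin m → FreeSemigroup E) : Prop :=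
  (∀ k, RegularElem (IG.mk B (w k))) ∧
    ∀ (bs : List (FreeSemigroup E)) (z : FreeSemigroup E), bs <:+: List.ofFn w →
      (bs.map fun s => (s : WithOne (FreeSemigroup E))).prod = z →
        RegularElem (IG.mk B z) → bs.length = 1

/-! ### Rees matrix coordinates of a regular `D`-class -/

/-- A choice of Rees matrix coordinates for a regular `D`-class `D`: an idempotent `ē` of `D`,
index sets `I` and `Λ` enumerating the `R`-classes and the `L`-classes of `D`, and representatives
`r i` of the `H`-classes in the `L`-class of `ē` and `q l` of those in the `R`-class of `ē`. -/
structure ReesCoord (D : Set (IG B)) where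
  /-- The base idempotent. -/
  base : E
  D_eq : D = {x | GreenD (IG.gen B base) x}
  /-- Indices of the `R`-classes. -/
  I : Type u
  /-- Indices of the `L`-classes. -/
  Λ : Type u
  /-- Representatives, in the `L`-class of the base idempotent, of the `R`-classes. -/
  r : I → IG B
  /-- Representatives, in the `R`-class of the base idempotent, of the `L`-classes. -/
  q : Λ → IG B
  r_mem : ∀ i, GreenL (IG.gen B base) (r i)
  q_mem : ∀ l, GreenR (IG.gen B base) (q l)
  r_enum : ∀ x ∈ D, ∃! i, GreenR (r i) x
  q_enum : ∀ x ∈ D, ∃! l, GreenL (q l) x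

namespace ReesCoord

variable {B} {D D₁ D₂ : Set (IG B)}

/-- The maximal subgroup of the `D`-class. -/
abbrev G (C : ReesCoord B D) : Type u := MaximalSubgroup (IG.idem B C.base)

/-- The element of the `D`-class written as the triple `(i, g, l)`. -/
def elem (C : ReesCoord B D) (i : C.I) (g : C.G) (l : C.Λ) : IG B := C.r i * g.1 * C.q l

/-- `σ_e i = j`, where the left multiplication by `ē` on the triples with first index `i`
is given by the group element `g`. -/
def Sigma (C : ReesCoord B D) (e : E) (i j : C.I) (g : C.G) : Prop :=
  ∀ h l, IG.gen B e * C.elem i h l = C.elem j (g * h) l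

/-- `l τ_e = l'`, where the right multiplication by `ē` on the triples with last index `l`
is given by the group element `g`. -/
def Tau (C : ReesCoord B D) (e : E) (l l' : C.Λ) (g : C.G) : Prop :=
  ∀ i h, C.elem i h l * IG.gen B e = C.elem i (h * g) l'

/-- Every `D`-class of a generator has Rees matrix coordinates. -/
theorem exists_reesCoord (B : BiorderedSet E) (b : E) :
    Nonempty (ReesCoord B {x | GreenD (IG.gen B b) x}) := by
  let D : Set (IG B) := {x | GreenD (IG.gen B b) x}
  let sR : Setoid D := ⟨fun x y => GreenR x.1 y.1, fun _ => rfl, Eq.symm, Eq.trans⟩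
  let sL : Setoid D := ⟨fun x y => GreenL x.1 y.1, fun _ => rfl, Eq.symm, Eq.trans⟩
  have hr : ∀ x : D, ∃ y, GreenL (IG.gen B b) y ∧ GreenR y x.1 :=
    fun x => GreenD.exists_greenL_greenR x.2
  have hq : ∀ x : D, ∃ y, GreenR (IG.gen B b) y ∧ GreenL y x.1 := fun x => x.2
  choose r hr1 hr2 using hr
  choose q hq1 hq2 using hq
  refine ⟨{ base := b, D_eq := rfl, I := Quotient sR, Λ := Quotient sL
            r := fun i => r i.out, q := fun l => q l.out
            r_mem := fun i => hr1 _, q_mem := fun l => hq1 _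
            r_enum := fun x hx => ⟨Quotient.mk sR ⟨x, hx⟩, ?_, ?_⟩
            q_enum := fun x hx => ⟨Quotient.mk sL ⟨x, hx⟩, ?_, ?_⟩ }⟩
  · exact (hr2 _).trans (Quotient.mk_out (s := sR) ⟨x, hx⟩)
  · intro j hj
    rw [← Quotient.out_eq j]
    exact Quotient.sound (s := sR) (show GreenR _ _ from (hr2 _).symm.trans hj)
  · exact (hq2 _).trans (Quotient.mk_out (s := sL) ⟨x, hx⟩)
  · intro j hj
    rw [← Quotient.out_eq j]
    exact Quotient.sound (s := sL) (show GreenL _ _ from (hq2 _).symm.trans hj)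

/-- Every element of the `D`-class is given by exactly one triple. -/
theorem elem_bijOn (C : ReesCoord B D) :
    Set.BijOn (fun t : C.I × C.G × C.Λ => C.elem t.1 t.2.1 t.2.2) Set.univ D := by
  have he := IG.gen_idem B C.base
  set e := IG.gen B C.base with hedef
  have hv : ∀ i, ∃ v, e * v = v ∧ v * C.r i = e := fun i => by
    rcases (greenL_iff.1 (C.r_mem i)).1 with h | ⟨v, h⟩
    · exact ⟨e, he, by rw [← h, ← hedef, he]⟩
    · exact ⟨e * v, by rw [← mul_assoc, he], by rw [mul_assoc, ← h, ← hedef, he]⟩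
  have hre : ∀ i, C.r i * e = C.r i := fun i => by
    rcases (greenL_iff.1 (C.r_mem i)).2 with h | ⟨v, h⟩
    · rw [h, ← hedef, he]
    · rw [h, mul_assoc, ← hedef, he]
  have hw : ∀ l, ∃ w, w * e = w ∧ C.q l * w = e := fun l => by
    rcases (greenR_iff.1 (C.q_mem l)).1 with h | ⟨v, h⟩
    · exact ⟨e, he, by rw [← h, ← hedef, he]⟩
    · exact ⟨v * e, by rw [mul_assoc, he], by rw [← mul_assoc, ← h, ← hedef, he]⟩
  have heq : ∀ l, e * C.q l = C.q l := fun l => by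
    rcases (greenR_iff.1 (C.q_mem l)).2 with h | ⟨v, h⟩
    · rw [h, ← hedef, he]
    · rw [h, ← mul_assoc, ← hedef, he]
  have hg : ∀ g : C.G, e * g.1 = g.1 ∧ g.1 * e = g.1 ∧
      ∃ y, e * y = y ∧ y * e = y ∧ g.1 * y = e ∧ y * g.1 = e := fun g =>
    (greenH_idem_iff he).1 g.2
  have hL : ∀ i g l, GreenL (C.q l) (C.elem i g l) := fun i g l => by
    obtain ⟨v, -, hv2⟩ := hv i
    obtain ⟨g1, -, y, -, -, -, y4⟩ := hg g
    refine greenL_iff.2 ⟨Or.inr ⟨y * v, ?_⟩, Or.inr ⟨C.r i * g.1, rfl⟩⟩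
    have : y * v * (C.r i * g.1 * C.q l) = y * ((v * C.r i) * g.1) * C.q l := by
      simp only [mul_assoc]
    rw [ReesCoord.elem, this, hv2, g1, y4, heq]
  have hR : ∀ i g l, GreenR (C.r i) (C.elem i g l) := fun i g l => by
    obtain ⟨w, -, hw2⟩ := hw l
    obtain ⟨g1, g2, y, -, -, y3, -⟩ := hg g
    refine greenR_iff.2 ⟨Or.inr ⟨w * y, ?_⟩, Or.inr ⟨g.1 * C.q l, mul_assoc _ _ _⟩⟩
    have : C.r i * g.1 * C.q l * (w * y) = C.r i * (g.1 * (C.q l * w) * y) := by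
      simp only [mul_assoc]
    rw [ReesCoord.elem, this, hw2, g2, y3, hre]
  have hD : ∀ i g l, C.elem i g l ∈ D := fun i g l =>
    (Set.ext_iff.1 C.D_eq _).2 ⟨C.q l, C.q_mem l, hL i g l⟩
  refine ⟨fun t _ => hD _ _ _, ?_, ?_⟩
  · rintro ⟨i, g, l⟩ - ⟨j, h, m⟩ - hx
    change C.elem i g l = C.elem j h m at hx
    obtain rfl : i = j := (C.r_enum _ (hD j h m)).unique (hx ▸ hR i g l) (hR j h m)
    obtain rfl : l = m := (C.q_enum _ (hD i h m)).unique (hx ▸ hL i g l) (hL i h m)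
    obtain ⟨v, -, hv2⟩ := hv i
    obtain ⟨w, -, hw2⟩ := hw l
    have key : ∀ g : C.G, v * C.elem i g l * w = g.1 := fun g => by
      have : v * (C.r i * g.1 * C.q l) * w = (v * C.r i) * g.1 * (C.q l * w) := by
        simp only [mul_assoc]
      rw [ReesCoord.elem, this, hv2, hw2, (hg g).1, (hg g).2.1]
    have : g = h := Subtype.ext (by rw [← key g, ← key h, hx])
    rw [this]
  · intro x hx
    obtain ⟨i, hi, -⟩ := C.r_enum x hx
    obtain ⟨l, hl, -⟩ := C.q_enum x hx
    obtain ⟨v, hv1, hv2⟩ := hv i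
    obtain ⟨w, hw1, hw2⟩ := hw l
    have hx1 : C.r i * v * x = x := by
      rcases (greenR_iff.1 hi).2 with h | ⟨s, h⟩
      · rw [h, mul_assoc, hv2, hre]
      · rw [h, mul_assoc, ← mul_assoc v, hv2, ← mul_assoc, hre]
    have hx2 : x * (w * C.q l) = x := by
      rcases (greenL_iff.1 hl).2 with h | ⟨s, h⟩
      · rw [h, ← mul_assoc, hw2, heq]
      · rw [h, mul_assoc, ← mul_assoc (C.q l), hw2, heq]
    have hs : ∃ s, v * x * s = e := by
      rcases (greenR_iff.1 hi).1 with h | ⟨s, h⟩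
      · exact ⟨e, by rw [← h, hv2, he]⟩
      · exact ⟨s, by rw [mul_assoc, ← h, hv2]⟩
    have ht : ∃ s, s * x * w = e := by
      rcases (greenL_iff.1 hl).1 with h | ⟨s, h⟩
      · exact ⟨e, by rw [← h, mul_assoc, hw2, he]⟩
      · exact ⟨s, by rw [← h, hw2]⟩
    obtain ⟨s, hs⟩ := hs
    obtain ⟨t, ht⟩ := ht
    have hH : GreenH e (v * x * w) := by
      refine ⟨greenR_iff.2 ⟨Or.inr ⟨C.q l * s, ?_⟩, Or.inr ⟨v * x * w, ?_⟩⟩,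
        greenL_iff.2 ⟨Or.inr ⟨t * C.r i, ?_⟩, Or.inr ⟨v * x * w, ?_⟩⟩⟩
      · have : v * x * w * (C.q l * s) = v * (x * (w * C.q l)) * s := by simp only [mul_assoc]
        rw [this, hx2, hs]
      · rw [← mul_assoc, ← mul_assoc, hv1]
      · have : t * C.r i * (v * x * w) = t * (C.r i * v * x) * w := by simp only [mul_assoc]
        rw [this, hx1, ht]
      · rw [mul_assoc (v * x) w e, hw1]
    refine ⟨(i, ⟨v * x * w, hH⟩, l), trivial, ?_⟩
    change C.r i * (v * x * w) * C.q l = x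
    have : C.r i * (v * x * w) * C.q l = C.r i * v * x * (w * C.q l) := by simp only [mul_assoc]
    rw [this, hx1, hx2]

end ReesCoord

end IG

/-! ### Gain graphs and the contact automaton -/

section Gain

variable {V : Type u} {G : Type u} [Group G]

/-- `Walk edge p q g`: there is a walk from `p` to `q` with gain `g`, where `edge p q g` says that
there is an edge from `p` to `q` with gain `g`. -/
inductive Walk (edge : V → V → G → Prop) : V → V → G → Prop
  | nil (p : V) : Walk edge p p 1
  | cons {p q s : V} {g h : G} : edge p q g → Walk edge q s h → Walk edge p s (g * h)

theorem Walk.append {edge : V → V → G → Prop} {p q s : V} {g h : G} (w : Walk edge p q g)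
    (w' : Walk edge q s h) : Walk edge p s (g * h) := by
  induction w with
  | nil p => rwa [one_mul]
  | cons he _ ih => rw [mul_assoc]; exact .cons he (ih w')

theorem Walk.reverse {edge : V → V → G → Prop} (hs : ∀ p q g, edge p q g → edge q p g⁻¹)
    {p q : V} {g : G} (w : Walk edge p q g) : Walk edge q p g⁻¹ := by
  induction w with
  | nil p => rw [inv_one]; exact .nil p
  | cons he _ ih =>
    rw [mul_inv_rev]
    refine ih.append ?_
    have := Walk.cons (hs _ _ _ he) (Walk.nil (edge := edge) _)
    rwa [mul_one] at this

/-- The vertex group of `p` in a gain graph: the gains of all closed walks based at `p`. -/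
def vertexGroup (edge : V → V → G → Prop) (hs : ∀ p q g, edge p q g → edge q p g⁻¹) (p : V) :
    Subgroup G where
  carrier := {g | Walk edge p p g}
  one_mem' := .nil p
  mul_mem' := fun h h' => h.append h'
  inv_mem' := fun h => h.reverse hs

end Gain

section Contact

variable {E : Type u} {B : BiorderedSet E} {D₁ D₂ : Set (IG B)}

/-- The edges of the contact automaton, with their labels in `G₁ × G₂ᵐᵒᵖ`. -/
inductive ContactEdge (C₁ : ReesCoord B D₁) (C₂ : ReesCoord B D₂) :
    C₁.Λ × C₂.I → C₁.Λ × C₂.I → C₁.G × C₂.Gᵐᵒᵖ → Prop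
  | fwd (e : E) {l l' : C₁.Λ} {i j : C₂.I} {g₁ : C₁.G} {g₂ : C₂.G} :
      C₁.Tau e l' l g₁ → C₂.Sigma e i j g₂ →
        ContactEdge C₁ C₂ (l, i) (l', j) (g₁⁻¹, MulOpposite.op g₂)
  | bwd (e : E) {l l' : C₁.Λ} {i j : C₂.I} {g₁ : C₁.G} {g₂ : C₂.G} :
      C₁.Tau e l l' g₁ → C₂.Sigma e j i g₂ →
        ContactEdge C₁ C₂ (l, i) (l', j) (g₁, (MulOpposite.op g₂)⁻¹)

theorem ContactEdge.symm (C₁ : ReesCoord B D₁) (C₂ : ReesCoord B D₂) :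
    ∀ p q g, ContactEdge C₁ C₂ p q g → ContactEdge C₁ C₂ q p g⁻¹ := by
  rintro _ _ _ (⟨e, h, h'⟩ | ⟨e, h, h'⟩)
  · rw [Prod.inv_mk, inv_inv]
    exact .bwd e h h'
  · rw [Prod.inv_mk, inv_inv]
    exact .fwd e h h'

/-- The vertex group `W_p` of a vertex `p` of the contact automaton. -/
noncomputable def contactGroup (C₁ : ReesCoord B D₁) (C₂ : ReesCoord B D₂) (p : C₁.Λ × C₂.I) :
    Subgroup (C₁.G × C₂.Gᵐᵒᵖ) :=
  vertexGroup (ContactEdge C₁ C₂) (ContactEdge.symm C₁ C₂) p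

open Classical in
/-- The right coset `W_p g` of the vertex group of `p`, where `g` is the label of a fixed walk from
`p` to `q` in the contact automaton; empty if there is no such walk. -/
noncomputable def walkCoset (C₁ : ReesCoord B D₁) (C₂ : ReesCoord B D₂) (p q : C₁.Λ × C₂.I) :
    Set (C₁.G × C₂.Gᵐᵒᵖ) :=
  if h : ∃ g, Walk (ContactEdge C₁ C₂) p q g then
    (fun w => w * h.choose) '' (contactGroup C₁ C₂ p : Set (C₁.G × C₂.Gᵐᵒᵖ))
  else ∅

end Contact

/-! ### The map `θ` -/

section Theta

variable {E : Type u} {B : BiorderedSet E} {n : ℕ} {D : Fin (n + 1) → Set (IG B)}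
  (C : ∀ k, ReesCoord B (D k))

/-- A decomposition `x = (i₁, a₁, l₁) ⋯ (iₘ, aₘ, lₘ)`, `m = n + 1`, of an element `x` with
fingerprint `(D₁, …, Dₘ)`, arising from a minimal r-factorisation of a word representing `x`. -/
structure Decomposition (x : IG B) where
  i : ∀ k, (C k).I
  a : ∀ k, (C k).G
  l : ∀ k, (C k).Λ
  /-- The factors of the word. -/
  word : Fin (n + 1) → FreeSemigroup E
  minimal : IsMinimalRFactorisation B word
  word_eq : ∀ k, IG.mk B (word k) = (C k).elem (i k) (a k) (l k)
  prod_eq : (List.ofFn fun k => (IG.mk B (word k) : WithOne (IG B))).prod = x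

variable {C} {x y : IG B} (P : Decomposition C x) (Q : Decomposition C y)

/-- The sets `A₁, …, Aₘ` (indexed from `0`): one passes from `A_k` to
`B_{k,k+1} = (A' × G_{k+1}) ∩ W g`, where `A' = A₁` if `k = 1` and `A' = a_k⁻¹ A_k⁻¹ b_k` if
`k > 1`, and then to its second projection. -/
noncomputable def thetaSeq (A : Set (C 0).G) : ∀ k : Fin (n + 1), Set (C k).G :=
  Fin.induction (motive := fun k => Set (C k).G) A fun k Ak =>
    {t | ∃ s ∈ (if (k : ℕ) = 0 then Ak
          else {s | ∃ z ∈ Ak, s = (P.a k.castSucc)⁻¹ * z⁻¹ * Q.a k.castSucc} : Set (C k.castSucc).G),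
        (s, MulOpposite.op t) ∈ walkCoset (C k.castSucc) (C k.succ)
          (P.l k.castSucc, P.i k.succ) (Q.l k.castSucc, Q.i k.succ)}

/-- The value of `θ` on a subset `A` of `G₁`: the last set `Aₘ`. -/
noncomputable def theta (A : Set (C 0).G) : Set (C (Fin.last n)).G :=
  thetaSeq P Q A (Fin.last n)

/-- The vertex group `W_{(l_k, i_{k+1})}`. -/
noncomputable def Decomposition.W (k : Fin n) : Subgroup ((C k.castSucc).G × (C k.succ).Gᵐᵒᵖ) :=
  contactGroup (C k.castSucc) (C k.succ) (P.l k.castSucc, P.i k.succ)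

end Theta

/-! ### Relative Howson property and relative coset intersection problem -/

section Howson

/-- The tall subgroups of `G₁ × G₂ᵐᵒᵖ`: those of the form `H × G₂` with `H` finitely generated. -/
def Tall (G₁ G₂ : Type u) [Group G₁] [Group G₂] : Set (Subgroup (G₁ × G₂ᵐᵒᵖ)) :=
  {K | ∃ H : Subgroup G₁, H.FG ∧ K = H.prod ⊤}

variable {G : Type u} [Group G]

/-- Group words over `n` generators; `(j, true)` is the `j`-th generator and `(j, false)` its
inverse. -/
abbrev GWord (n : ℕ) : Type := List (Fin n × Bool)

/-- The element of the group represented by a word over the generators `X`. -/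
def GWord.eval {n : ℕ} (X : Fin n → G) (w : GWord n) : G :=
  (w.map fun p => if p.2 then X p.1 else (X p.1)⁻¹).prod

/-- `X` is a finite generating tuple of the group. -/
def Generates {n : ℕ} (X : Fin n → G) : Prop := Subgroup.closure (Set.range X) = ⊤

/-- The subgroup generated by a finite list of words. -/
def genBy {n : ℕ} (X : Fin n → G) (ws : List (GWord n)) : Subgroup G :=
  Subgroup.closure {g | ∃ w ∈ ws, GWord.eval X w = g}

/-- The `(H, 𝒦)`-relative Howson property. -/
def RelHowson (H : Subgroup G) (𝒦 : Set (Subgroup G)) : Prop :=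
  ∀ K : Subgroup G, K.FG → K ∈ 𝒦 → (H ⊓ K).FG

/-- The effective `(H, 𝒦)`-relative Howson property. The algorithm has to succeed only on
generating sets of members of `𝒦`. -/
def EffRelHowson (H : Subgroup G) (𝒦 : Set (Subgroup G)) : Prop :=
  RelHowson H 𝒦 ∧ ∃ (n : ℕ) (X : Fin n → G), Generates X ∧
    ∃ f : List (GWord n) →. List (GWord n), Partrec f ∧
      ∀ ws, genBy X ws ∈ 𝒦 → ∃ out ∈ f ws, genBy X out = H ⊓ genBy X ws

/-- The `(H, 𝒦)`-relative coset intersection problem is solvable: an algorithm decides,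
given a generating set of `K ∈ 𝒦` and `x`, `y`, whether `H x ∩ K y` is empty, and if not finds
an element of it. -/
def RelCosetIntersectionSolvable (H : Subgroup G) (𝒦 : Set (Subgroup G)) : Prop :=
  ∃ (n : ℕ) (X : Fin n → G), Generates X ∧
    ∃ f : List (GWord n) × GWord n × GWord n →. Option (GWord n), Partrec f ∧
      ∀ ws x y, genBy X ws ∈ 𝒦 → ∃ out ∈ f (ws, x, y),
        let T : Set G := (fun h => h * GWord.eval X x) '' (H : Set G) ∩
          (fun k => k * GWord.eval X y) '' (genBy X ws : Set G)
        (out = none ↔ T = ∅) ∧ ∀ z, out = some z → GWord.eval X z ∈ T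

end Howson

end FreeIG

/-! Each passage from `A_k` to `A_{k+1}` is coset arithmetic. If `A_k' = Lx`, the pairs of `Wg` with
first coordinate in `Lx` form `Wg ∩ (L × G₂ᵐᵒᵖ)(x, 1)`, an intersection of two right cosets: it is
empty or equal to `(W ∩ (L × G₂ᵐᵒᵖ))z`. Its second projection is a right coset in the dual group,
hence a left coset `yM` in `G₂` (`transfer_eq_leftCoset`). Then `a⁻¹(yM)⁻¹b = (a⁻¹Ma)(a⁻¹y⁻¹b)` is a
right coset again (`mul_leftCoset_inv_mul`), so the induction continues and gives part 1.

For part 2, `M` is a homomorphic image of `W` intersected with a tall subgroup, so the Howson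
property makes it finitely generated. That property concerns finitely generated members of the
class, and `H × G₂ᵐᵒᵖ` is finitely generated because `G₂` is. Here finiteness of the biordered set
enters: `IG.maximalSubgroup_fg` is a Schreier-type argument.

For part 3 the same formulas are run on words (`CodeComputable.transfer`): the coset intersection
algorithm detects emptiness or finds `z`, and the effective Howson property yields generators of the
intersection. Since the two decompositions are fixed, the middle entries, the coset representatives
and the existence of connecting walks are constants of the algorithm. -/

namespace FreeIG

/-! ### Translating Green's relations -/

section Green

variable {S : Type u} [Semigroup S]

theorem GreenR.mul_left {a b : S} (h : GreenR a b) (c : S) : GreenR (c * a) (c * b) := by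
  obtain ⟨h1, h2⟩ := greenR_iff.1 h
  refine greenR_iff.2 ⟨?_, ?_⟩
  · rcases h1 with rfl | ⟨s, rfl⟩
    · exact Or.inl rfl
    · exact Or.inr ⟨s, (mul_assoc _ _ _).symm⟩
  · rcases h2 with rfl | ⟨s, rfl⟩
    · exact Or.inl rfl
    · exact Or.inr ⟨s, (mul_assoc _ _ _).symm⟩

theorem GreenL.mul_right {a b : S} (h : GreenL a b) (c : S) : GreenL (a * c) (b * c) := by
  obtain ⟨h1, h2⟩ := greenL_iff.1 h
  refine greenL_iff.2 ⟨?_, ?_⟩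
  · rcases h1 with rfl | ⟨s, rfl⟩
    · exact Or.inl rfl
    · exact Or.inr ⟨s, mul_assoc _ _ _⟩
  · rcases h2 with rfl | ⟨s, rfl⟩
    · exact Or.inl rfl
    · exact Or.inr ⟨s, mul_assoc _ _ _⟩

theorem GreenR.idem_mul {e x : S} (he : e * e = e) (h : GreenR e x) : e * x = x := by
  rcases (greenR_iff.1 h).2 with rfl | ⟨s, rfl⟩
  · exact he
  · rw [← mul_assoc, he]

theorem GreenR.exists_mul_eq {e x : S} (he : e * e = e) (h : GreenR e x) :
    ∃ y, y * e = y ∧ x * y = e := by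
  rcases (greenR_iff.1 h).1 with h1 | ⟨s, h1⟩
  · exact ⟨e, he, by rw [← h1, he]⟩
  · exact ⟨s * e, by rw [mul_assoc, he], by rw [← mul_assoc, ← h1, he]⟩

/-- Passing from `x` to an `L`-related element transports the relation `x c R x`. -/
theorem GreenR.of_greenL {f x c : S} (hL : GreenL f x) (hR : GreenR (x * c) x) :
    GreenR (f * c) f := by
  rcases (greenL_iff.1 hL).1 with rfl | ⟨z, rfl⟩
  · exact hR
  · rw [mul_assoc]
    exact hR.mul_left z

/-- Right multiplication only descends in the `R`-order, so a product that ends in the `R`-class of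
`e` never left it along the way. This permits induction on the letters of a word. -/
theorem GreenR.of_mul_mul {e x a y : S} (hx : GreenR e x) (h : GreenR e (x * (a * y))) :
    GreenR e (x * a) := by
  refine greenR_iff.2 ⟨?_, ?_⟩
  · rcases (greenR_iff.1 h).1 with h1 | ⟨s, h1⟩
    · exact Or.inr ⟨y, by rw [mul_assoc]; exact h1⟩
    · exact Or.inr ⟨y * s, by rw [h1]; simp only [mul_assoc]⟩
  · rw [show rightIdeal e = rightIdeal x from hx]
    exact Or.inr ⟨a, rfl⟩

end Green

/-! ### Finite generation of the maximal subgroups -/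

section IG

variable {E : Type u} (B : BiorderedSet E)

/-- A realisation of the biordered set extends to the free idempotent generated semigroup. -/
theorem IG.exists_hom {S : Type u} [Semigroup S] (φ : E → S)
    (h : ∀ e f g, B.pmul e f = some g → φ e * φ f = φ g) :
    ∃ Φ : IG B →ₙ* S, ∀ e, Φ (IG.gen B e) = φ e := by
  have hle : conGen (IGRel B) ≤ Con.ker (FreeSemigroup.lift φ) := by
    refine Con.conGen_le.2 ?_
    rintro _ _ ⟨e, f, g, hg⟩
    change FreeSemigroup.lift φ _ = FreeSemigroup.lift φ _
    simpa using h e f g hg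
  refine ⟨⟨Quotient.lift (FreeSemigroup.lift φ) fun a b hab => hle hab, ?_⟩, ?_⟩
  · rintro ⟨x⟩ ⟨y⟩
    exact map_mul (FreeSemigroup.lift φ) x y
  · intro e
    exact FreeSemigroup.lift_of φ e

theorem IG.induction_on {p : IG B → Prop} (x : IG B) (hgen : ∀ e, p (IG.gen B e))
    (hmul : ∀ e y, p y → p (IG.gen B e * y)) : p x := by
  obtain ⟨w⟩ := x
  change p (IG.mk B w)
  induction w using FreeSemigroup.recOnMul with
  | ih1 e => exact hgen e
  | ih2 e y _ hy => exact hmul e _ hy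

/-- If `ē ā` is `R`-related to `ē`, then it is `L`-related to a generator. -/
theorem IG.exists_gen_greenL (e a : E) (h : GreenR (IG.gen B e * IG.gen B a) (IG.gen B e)) :
    ∃ f, GreenL (IG.gen B f) (IG.gen B e * IG.gen B a) := by
  obtain ⟨S, _, φ, hinj, hr, hp⟩ := B.exists_semigroup
  obtain ⟨Φ, hΦ⟩ := IG.exists_hom B φ fun e f g hg => ((hp e f g).1 hg).2
  have hid : ∀ x, φ x * φ x = φ x := fun x => by
    have : φ x ∈ Set.range φ := ⟨x, rfl⟩
    rwa [hr] at this
  have hmem : ∀ s : S, s * s = s → ∃ x, φ x = s := fun s hs => by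
    have : s ∈ Set.range φ := by rw [hr]; exact hs
    exact this
  obtain ⟨s, -, hs⟩ := GreenR.exists_mul_eq (IG.gen_idem B e) h.symm
  have hs' : φ e * φ a * Φ s = φ e := by
    rw [← hΦ e, ← hΦ a, ← map_mul, ← map_mul, hs]
  -- As `s` undoes right multiplication of `e` by `a`, the element `a s e` is an idempotent of the
  -- realisation; it is `L`-related to `e` and fixed by `a` on the left.
  obtain ⟨f, hf⟩ := hmem (φ a * Φ s * φ e) (by
    calc φ a * Φ s * φ e * (φ a * Φ s * φ e)
        = φ a * Φ s * (φ e * φ a * Φ s) * φ e := by simp only [mul_assoc]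
      _ = φ a * Φ s * φ e := by rw [hs', mul_assoc, hid])
  have haf : φ a * φ f = φ f := by rw [hf, ← mul_assoc, ← mul_assoc, hid]
  have hfe : φ f * φ e = φ f := by rw [hf, mul_assoc, hid]
  have hef : φ e * φ f = φ e := by rw [hf, ← mul_assoc, ← mul_assoc, hs', hid]
  obtain ⟨g, hg⟩ := hmem (φ f * φ a) (by
    rw [mul_assoc, ← mul_assoc (φ a), haf, ← mul_assoc, hid])
  -- All three products are of basic pairs, so they lift from the realisation to the free object.
  -- From `e L f` there follows `ea L fa = g`.
  have pef := IG.gen_mul_of_pmul B ((hp e f e).2 ⟨Or.inl hef, hef⟩)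
  have pfe := IG.gen_mul_of_pmul B ((hp f e f).2 ⟨Or.inl hfe, hfe⟩)
  have pfa := IG.gen_mul_of_pmul B ((hp f a g).2 ⟨Or.inr (Or.inr (Or.inl haf)), hg.symm⟩)
  refine ⟨g, greenL_iff.2 ⟨Or.inr ⟨IG.gen B f, ?_⟩, Or.inr ⟨IG.gen B e, ?_⟩⟩⟩
  · rw [← mul_assoc, pfe, pfa]
  · rw [← pfa, ← mul_assoc, pef]

/-- The maximal subgroups of the free idempotent generated semigroup over a finite biordered set
are finitely generated. -/
theorem IG.maximalSubgroup_fg [Finite E] (b : E) : Group.FG (MaximalSubgroup (IG.idem B b)) := by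
  have he := IG.gen_idem B b
  set e := IG.gen B b with hedef
  let T : Type u := {f : E // ∃ x, GreenR e x ∧ GreenL (IG.gen B f) x}
  choose q hqR hqL using fun f : T => f.2
  choose q' hq'e hqq' using fun f : T => (hqR f).exists_mul_eq he
  let G := MaximalSubgroup (IG.idem B b)
  have hG : ∀ c : G, GreenR e c.1 ∧ e * c.1 = c.1 ∧ c.1 * e = c.1 ∧ (c⁻¹).1 * c.1 = e ∧
      c.1 * (c⁻¹).1 = e := fun c =>
    ⟨c.2.1, ((greenH_idem_iff he).1 c.2).1, ((greenH_idem_iff he).1 c.2).2.1,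
      congrArg Subtype.val (inv_mul_cancel c), congrArg Subtype.val (mul_inv_cancel c)⟩
  -- Schreier generators: one representative `q f` per idempotent `f` whose `L`-class meets the
  -- `R`-class of `e`, and the products `q f · a · q' f'`. Finiteness of `E` makes the set finite;
  -- only its members inside the group are kept.
  let X : Set (IG B) := Set.range q ∪
    Set.range fun t : T × E × T => q t.1 * IG.gen B t.2.1 * q' t.2.2
  have hX : X.Finite := (Set.finite_range _).union (Set.finite_range _)
  let XG : Set G := Subtype.val ⁻¹' X
  have hXG : XG.Finite := hX.preimage Subtype.val_injective.injOn
  let K : Subgroup G := Subgroup.closure XG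
  have key : ∀ y x : IG B, GreenR e x → GreenR e (x * y) →
      (∃ (f : T) (c : G), c ∈ K ∧ x = c.1 * q f) →
      ∃ (f : T) (c : G), c ∈ K ∧ x * y = c.1 * q f := by
    -- Reading one letter turns `c · q f` into `c · (q f · a · q' f₂) · q f₂`, where the bracket is
    -- a Schreier generator.
    have step : ∀ (a : E) (x : IG B), GreenR e x → GreenR e (x * IG.gen B a) →
        (∃ (f : T) (c : G), c ∈ K ∧ x = c.1 * q f) →
        ∃ (f : T) (c : G), c ∈ K ∧ x * IG.gen B a = c.1 * q f := by
      rintro a _ - hxa ⟨f, c, hc, rfl⟩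
      obtain ⟨-, -, -, hc1, -⟩ := hG c
      have hqa : GreenR e (q f * IG.gen B a) := by
        have h1 := hxa.mul_left (c⁻¹).1
        rw [(hG c⁻¹).2.2.1, ← mul_assoc, ← mul_assoc, hc1, (hqR f).idem_mul he] at h1
        exact (hG c⁻¹).1.trans h1
      obtain ⟨f', hf'⟩ := IG.exists_gen_greenL B f.1 a
        (GreenR.of_greenL (hqL f) (hqa.symm.trans (hqR f)))
      -- The new `L`-class again contains a generator, so it is among those indexed by `T`.
      have hf'' : GreenL (IG.gen B f') (q f * IG.gen B a) := hf'.trans ((hqL f).mul_right _)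
      let f₂ : T := ⟨f', _, hqa, hf''⟩
      have hL : GreenL (q f₂) (q f * IG.gen B a) := (hqL f₂).symm.trans hf''
      have hqq : q f * IG.gen B a * q' f₂ * q f₂ = q f * IG.gen B a := by
        rcases (greenL_iff.1 hL).2 with h | ⟨z, h⟩
        · rw [h, hqq', (hqR f₂).idem_mul he]
        · rw [h, mul_assoc z, hqq', mul_assoc, (hqR f₂).idem_mul he]
      have hd : GreenH e (q f * IG.gen B a * q' f₂) := by
        refine ⟨hqa.trans (greenR_iff.2 ⟨Or.inr ⟨q f₂, hqq.symm⟩, Or.inr ⟨q' f₂, rfl⟩⟩),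
          greenL_iff.2 ⟨?_, Or.inr ⟨q f * IG.gen B a * q' f₂, by simp only [mul_assoc, hq'e]⟩⟩⟩
        rcases (greenL_iff.1 hL).1 with h | ⟨z, h⟩
        · exact Or.inl (by rw [← h, hqq'])
        · exact Or.inr ⟨z, by rw [← mul_assoc, ← h, hqq']⟩
      refine ⟨f₂, c * ⟨_, hd⟩, K.mul_mem hc (Subgroup.subset_closure
        (Or.inr ⟨(f, a, f₂), rfl⟩)), ?_⟩
      calc c.1 * q f * IG.gen B a = c.1 * (q f * IG.gen B a) := mul_assoc _ _ _
        _ = c.1 * (q f * IG.gen B a * q' f₂ * q f₂) := by rw [hqq]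
        _ = c.1 * (q f * IG.gen B a * q' f₂) * q f₂ := (mul_assoc _ _ _).symm
    intro y
    induction y using IG.induction_on with
    | hgen a => exact step a
    | hmul a y ih =>
      intro x hx hxy hc
      have hxa := GreenR.of_mul_mul hx hxy
      rw [← mul_assoc] at hxy ⊢
      exact ih _ hxa hxy (step a x hx hxa hc)
  -- The representative `q b` need not be `e`, but it lies in the group and is one of the
  -- generators, so its inverse corrects it.
  have hstart : ∃ (f : T) (c : G), c ∈ K ∧ e = c.1 * q f := by
    let f : T := ⟨b, e, rfl, rfl⟩
    let c : G := ⟨q f, hqR f, hqL f⟩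
    exact ⟨f, c⁻¹, K.inv_mem (Subgroup.subset_closure (Or.inl ⟨f, rfl⟩)), (hG c).2.2.2.1.symm⟩
  rw [Group.fg_iff]
  refine ⟨XG, (Subgroup.eq_top_iff' K).2 fun x => ?_, hXG⟩
  obtain ⟨f, c, hc, hx⟩ := key x.1 e rfl (by rw [(hG x).2.1]; exact (hG x).1) hstart
  rw [(hG x).2.1] at hx
  -- The representative left over after reading all of `x` lies in the group, hence is itself a
  -- generator.
  have hq : (c⁻¹ * x).1 = q f := by
    change (c⁻¹).1 * x.1 = _
    rw [hx, ← mul_assoc, (hG c).2.2.2.1, (hqR f).idem_mul he]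
  have := K.mul_mem hc (Subgroup.subset_closure (Or.inl ⟨f, hq.symm⟩ : c⁻¹ * x ∈ XG))
  rwa [mul_inv_cancel_left] at this

end IG

/-! ### Coset arithmetic for one passage of `θ` -/

section Transfer

variable {G₁ G₂ : Type u}

/-- The elements of `G₂` matched by `V` with an element of `A`. -/
def transfer (V : Set (G₁ × G₂ᵐᵒᵖ)) (A : Set G₁) : Set G₂ :=
  {t | ∃ s ∈ A, (s, MulOpposite.op t) ∈ V}

theorem transfer_empty (V : Set (G₁ × G₂ᵐᵒᵖ)) : transfer V ∅ = ∅ := by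
  simp [transfer]

theorem empty_transfer (A : Set G₁) : transfer (∅ : Set (G₁ × G₂ᵐᵒᵖ)) A = ∅ := by
  simp [transfer]

variable [Group G₁] [Group G₂]

theorem mem_rightCoset {G : Type u} [Group G] {H : Subgroup G} {x s : G} :
    s ∈ (fun g => g * x) '' (H : Set G) ↔ s * x⁻¹ ∈ H := by
  rw [Set.image_mul_right]; rfl

theorem mem_leftCoset {G : Type u} [Group G] {H : Subgroup G} {y s : G} :
    s ∈ (fun g => y * g) '' (H : Set G) ↔ y⁻¹ * s ∈ H := by
  rw [Set.image_mul_left]; rfl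

/-- A left coset determines its subgroup, so part 2 holds for every presentation `yM`, not only for
the one constructed. -/
theorem subgroup_eq_of_leftCoset_eq {G : Type u} [Group G] {H K : Subgroup G} {x y : G}
    (h : (fun g => x * g) '' (H : Set G) = (fun g => y * g) '' (K : Set G)) : H = K := by
  have hx : y⁻¹ * x ∈ K := by
    rw [← mem_leftCoset, ← h, mem_leftCoset, inv_mul_cancel]
    exact H.one_mem
  ext g
  have := Set.ext_iff.1 h (x * g)
  rwa [mem_leftCoset, mem_leftCoset, inv_mul_cancel_left, ← mul_assoc,
    Subgroup.mul_mem_cancel_left _ hx] at this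

theorem fg_map {G G' : Type u} [Group G] [Group G'] {H : Subgroup G} (hH : H.FG) (f : G →* G') :
    (H.map f).FG := by
  obtain ⟨s, rfl, hs⟩ := (Subgroup.fg_iff H).1 hH
  exact (Subgroup.fg_iff _).2 ⟨f '' s, (MonoidHom.map_closure f s).symm, hs.image f⟩

theorem mem_map_conj {G : Type u} [Group G] {H : Subgroup G} {c g : G} :
    g ∈ H.map (MulAut.conj c).toMonoidHom ↔ c⁻¹ * g * c ∈ H := by
  constructor
  · rintro ⟨h, hh, rfl⟩
    simpa [mul_assoc] using hh
  · intro h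
    exact ⟨_, h, by simp [mul_assoc]⟩

theorem leftCoset_eq_rightCoset {G : Type u} [Group G] (H : Subgroup G) (y : G) :
    (fun g => y * g) '' (H : Set G) =
      (fun g => g * y) '' (H.map (MulAut.conj y).toMonoidHom : Set G) := by
  ext s
  rw [mem_leftCoset, mem_rightCoset, mem_map_conj]
  simp [mul_assoc]

theorem rightCoset_eq_leftCoset {G : Type u} [Group G] (H : Subgroup G) (x : G) :
    (fun g => g * x) '' (H : Set G) =
      (fun g => x * g) '' (H.map (MulAut.conj x⁻¹).toMonoidHom : Set G) := by
  ext s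
  rw [mem_leftCoset, mem_rightCoset, mem_map_conj]
  simp

/-- Inversion exchanges left and right cosets; this is why the output of one passage is a legitimate
input of the next. -/
theorem mul_leftCoset_inv_mul {G : Type u} [Group G] (H : Subgroup G) (a b y : G) :
    {s | ∃ z ∈ (fun g => y * g) '' (H : Set G), s = a⁻¹ * z⁻¹ * b} =
      (fun g => g * (a⁻¹ * y⁻¹ * b)) '' (H.map (MulAut.conj a⁻¹).toMonoidHom : Set G) := by
  ext s
  rw [mem_rightCoset, mem_map_conj]
  constructor
  · rintro ⟨z, hz, rfl⟩
    rw [mem_leftCoset] at hz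
    simpa [mul_assoc] using H.inv_mem hz
  · intro h
    refine ⟨b * s⁻¹ * a⁻¹, ?_, by simp [mul_assoc]⟩
    rw [mem_leftCoset]
    simpa [mul_assoc] using H.inv_mem h

/-- The homomorphism `(g, h) ↦ h⁻¹` of `G₁ × G₂ᵐᵒᵖ` to `G₂`. -/
def sndInv (G₁ G₂ : Type u) [Group G₁] [Group G₂] : G₁ × G₂ᵐᵒᵖ →* G₂ :=
  (MulEquiv.inv' G₂).symm.toMonoidHom.comp (MonoidHom.snd G₁ G₂ᵐᵒᵖ)

@[simp]
theorem sndInv_apply (z : G₁ × G₂ᵐᵒᵖ) : sndInv G₁ G₂ z = (MulOpposite.unop z.2)⁻¹ := rfl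

/-- With a common point `z` of the two right cosets, `(s, t)` lies in both exactly when `z (s, t)⁻¹`
lies in both subgroups. Applying `sndInv`, which undoes the dual, sends this element to `sndInv z *
t`. -/
theorem transfer_eq_leftCoset {W : Subgroup (G₁ × G₂ᵐᵒᵖ)} {g : G₁ × G₂ᵐᵒᵖ} {L : Subgroup G₁}
    {x : G₁} {z : G₁ × G₂ᵐᵒᵖ} (hz : z ∈ (fun w => w * g) '' (W : Set (G₁ × G₂ᵐᵒᵖ)))
    (hz' : z ∈ (fun k => k * (x, 1)) '' ((L.prod ⊤ : Subgroup (G₁ × G₂ᵐᵒᵖ)) : Set (G₁ × G₂ᵐᵒᵖ))) :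
    transfer ((fun w => w * g) '' (W : Set (G₁ × G₂ᵐᵒᵖ))) ((fun g => g * x) '' (L : Set G₁)) =
      (fun t => (sndInv G₁ G₂ z)⁻¹ * t) '' ((W ⊓ L.prod ⊤).map (sndInv G₁ G₂) : Set G₂) := by
  rw [mem_rightCoset] at hz hz'
  have hz1 : z.1 * x⁻¹ ∈ L := (Subgroup.mem_prod.1 hz').1
  ext t
  rw [mem_leftCoset]
  constructor
  · rintro ⟨s, hs, hV⟩
    rw [mem_rightCoset] at hs hV
    refine ⟨z * (s, MulOpposite.op t)⁻¹, ⟨?_, Subgroup.mem_prod.2 ⟨?_, trivial⟩⟩, ?_⟩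
    · simpa [mul_assoc] using W.mul_mem hz (W.inv_mem hV)
    · simpa [mul_assoc] using L.mul_mem hz1 (L.inv_mem hs)
    · simp
  · rintro ⟨w, ⟨hW, hK⟩, hw⟩
    have hw1 : w.1 ∈ L := (Subgroup.mem_prod.1 hK).1
    refine ⟨w.1⁻¹ * z.1, ?_, ?_⟩
    · rw [mem_rightCoset, mul_assoc]
      exact L.mul_mem (L.inv_mem hw1) hz1
    · have : (w.1⁻¹ * z.1, MulOpposite.op t) = w⁻¹ * z := by
        refine Prod.ext rfl (MulOpposite.unop_injective ?_)
        simp only [sndInv_apply, inv_inv] at hw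
        simp [hw]
      rw [mem_rightCoset, this, mul_assoc]
      exact W.mul_mem (W.inv_mem hW) hz

theorem transfer_eq_empty {V : Set (G₁ × G₂ᵐᵒᵖ)} {L : Subgroup G₁} {x : G₁}
    (h : V ∩ (fun k => k * (x, 1)) '' ((L.prod ⊤ : Subgroup (G₁ × G₂ᵐᵒᵖ)) : Set (G₁ × G₂ᵐᵒᵖ)) = ∅) :
    transfer V ((fun g => g * x) '' (L : Set G₁)) = ∅ := by
  refine Set.eq_empty_of_forall_notMem ?_
  rintro t ⟨s, hs, hV⟩
  rw [mem_rightCoset] at hs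
  refine Set.eq_empty_iff_forall_notMem.1 h _ ⟨hV, mem_rightCoset.2 ?_⟩
  exact Subgroup.mem_prod.2 ⟨hs, trivial⟩

end Transfer

/-! ### Induction along `θ`: parts 1 and 2 -/

section Theta

variable {E : Type u} {B : BiorderedSet E}

theorem walkCoset_eq_empty_or {D₁ D₂ : Set (IG B)} (C₁ : ReesCoord B D₁) (C₂ : ReesCoord B D₂)
    (p q : C₁.Λ × C₂.I) : walkCoset C₁ C₂ p q = ∅ ∨ ∃ g, walkCoset C₁ C₂ p q =
      (fun w => w * g) '' (contactGroup C₁ C₂ p : Set (C₁.G × C₂.Gᵐᵒᵖ)) := by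
  unfold walkCoset
  split_ifs with h
  · exact Or.inr ⟨_, rfl⟩
  · exact Or.inl rfl

variable {n : ℕ} {D : Fin (n + 1) → Set (IG B)} {C : ∀ k, ReesCoord B (D k)} {x y : IG B}
  (P : Decomposition C x) (Q : Decomposition C y)

/-- The passage from `A_k` to `A_k'`. -/
def thetaPrep (k : Fin n) (A : Set (C k.castSucc).G) : Set (C k.castSucc).G :=
  if (k : ℕ) = 0 then A
  else {s | ∃ z ∈ A, s = (P.a k.castSucc)⁻¹ * z⁻¹ * Q.a k.castSucc}

theorem thetaSeq_succ (A : Set (C 0).G) (k : Fin n) :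
    thetaSeq P Q A k.succ = transfer (walkCoset (C k.castSucc) (C k.succ)
      (P.l k.castSucc, P.i k.succ) (Q.l k.castSucc, Q.i k.succ))
        (thetaPrep P Q k (thetaSeq P Q A k.castSucc)) := rfl

theorem thetaPrep_leftCoset (k : Fin n) (M : Subgroup (C k.castSucc).G) (y : (C k.castSucc).G) :
    ∃ c x, thetaPrep P Q k ((fun g => y * g) '' (M : Set (C k.castSucc).G)) =
      (fun g => g * x) '' (M.map (MulAut.conj c).toMonoidHom : Set (C k.castSucc).G) := by
  unfold thetaPrep
  split_ifs
  · exact ⟨_, _, leftCoset_eq_rightCoset M y⟩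
  · exact ⟨_, _, mul_leftCoset_inv_mul M _ _ y⟩

theorem thetaPrep_empty (k : Fin n) : thetaPrep P Q k ∅ = ∅ := by
  simp [thetaPrep]

/-- Finite generation is carried through the same induction because it refers to the subgroup built
at each stage. The start `Lx` is rewritten as the left coset `x(x⁻¹Lx)`, so that one invariant
serves all indices. -/
theorem thetaSeq_eq_empty_or_leftCoset [Finite E] (L : Subgroup (C 0).G) (x : (C 0).G)
    (k : Fin (n + 1)) :
    thetaSeq P Q ((fun g => g * x) '' (L : Set (C 0).G)) k = ∅ ∨
      ∃ (M : Subgroup (C k).G) (y : (C k).G),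
        thetaSeq P Q ((fun g => g * x) '' (L : Set (C 0).G)) k =
          (fun g => y * g) '' (M : Set (C k).G) ∧
        ((∀ k : Fin n, RelHowson (P.W k) (Tall (C k.castSucc).G (C k.succ).G)) → L.FG → M.FG) := by
  induction k using Fin.induction with
  | zero =>
    exact Or.inr ⟨_, _, rightCoset_eq_leftCoset L x, fun _ hL => fg_map hL _⟩
  | succ k ih =>
    rw [thetaSeq_succ]
    rcases ih with h | ⟨M, y, h, hM⟩
    · exact Or.inl (by rw [h, thetaPrep_empty, transfer_empty])
    obtain ⟨c, x', h'⟩ := thetaPrep_leftCoset P Q k M y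
    rw [h, h']
    rcases walkCoset_eq_empty_or (C k.castSucc) (C k.succ)
      (P.l k.castSucc, P.i k.succ) (Q.l k.castSucc, Q.i k.succ) with hV | ⟨g, hV⟩
    · exact Or.inl (by rw [hV, empty_transfer])
    rw [hV]
    rcases Set.eq_empty_or_nonempty ((fun w => w * g) '' (contactGroup (C k.castSucc) (C k.succ)
        (P.l k.castSucc, P.i k.succ) : Set ((C k.castSucc).G × (C k.succ).Gᵐᵒᵖ)) ∩
        (fun k => k * (x', 1)) '' (((M.map (MulAut.conj c).toMonoidHom).prod ⊤ :
          Subgroup ((C k.castSucc).G × (C k.succ).Gᵐᵒᵖ)) :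
            Set ((C k.castSucc).G × (C k.succ).Gᵐᵒᵖ))) with h0 | ⟨z, hz, hz'⟩
    · exact Or.inl (transfer_eq_empty h0)
    · refine Or.inr ⟨_, _, transfer_eq_leftCoset hz hz', fun hH hL => ?_⟩
      -- The Howson hypothesis applies only to finitely generated tall subgroups, so the second
      -- factor has to be finitely generated.
      have hfg : (⊤ : Subgroup (C k.succ).Gᵐᵒᵖ).FG := by
        have := IG.maximalSubgroup_fg B (C k.succ).base
        exact (Group.fg_of_surjective (MulEquiv.inv' (C k.succ).G).surjective
          (f := (MulEquiv.inv' (C k.succ).G).toMonoidHom)).out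
      have hM' := fg_map (hM hH hL) (MulAut.conj c).toMonoidHom
      exact fg_map (hH k _ (hM'.prod hfg) ⟨_, hM', rfl⟩) _

end Theta

/-! ### Computing with group words -/

section Words

variable {G G' : Type u} [Group G] [Group G']

theorem GWord.eval_append {n : ℕ} (X : Fin n → G) (v w : GWord n) :
    GWord.eval X (v ++ w) = GWord.eval X v * GWord.eval X w := by
  simp [GWord.eval]

/-- The formal inverse of a group word. -/
def GWord.inv {n : ℕ} (w : GWord n) : GWord n := (w.map fun p => (p.1, !p.2)).reverse

theorem GWord.eval_inv {n : ℕ} (X : Fin n → G) (w : GWord n) :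
    GWord.eval X (GWord.inv w) = (GWord.eval X w)⁻¹ := by
  induction w with
  | nil => simp [GWord.eval, GWord.inv]
  | cons p w ih =>
    have h1 : GWord.inv (p :: w) = GWord.inv w ++ [(p.1, !p.2)] := by simp [GWord.inv]
    have h2 : GWord.eval X (p :: w) = GWord.eval X [p] * GWord.eval X w :=
      GWord.eval_append X [p] w
    rw [h1, h2, GWord.eval_append, ih, mul_inv_rev]
    obtain ⟨j, b⟩ := p
    cases b <;> simp [GWord.eval]

theorem GWord.primrec_inv {n : ℕ} : Primrec (GWord.inv (n := n)) :=
  Primrec.list_reverse.comp (Primrec.list_map Primrec.id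
    ((Primrec.dom_finite fun p : Fin n × Bool => (p.1, !p.2)).comp Primrec.snd).to₂)

theorem Generates.exists_eval {n : ℕ} {X : Fin n → G} (hX : Generates X) (g : G) :
    ∃ w, GWord.eval X w = g := by
  have hg : g ∈ Subgroup.closure (Set.range X) := by rw [hX]; trivial
  induction hg using Subgroup.closure_induction with
  | mem x hx =>
    obtain ⟨j, rfl⟩ := hx
    exact ⟨[(j, true)], by simp [GWord.eval]⟩
  | one => exact ⟨[], by simp [GWord.eval]⟩
  | mul x y _ _ hx hy =>
    obtain ⟨v, rfl⟩ := hx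
    obtain ⟨w, rfl⟩ := hy
    exact ⟨v ++ w, GWord.eval_append X v w⟩
  | inv x _ hx =>
    obtain ⟨v, rfl⟩ := hx
    exact ⟨GWord.inv v, GWord.eval_inv X v⟩

theorem Generates.map_surjective {n : ℕ} {X : Fin n → G} (hX : Generates X) {f : G →* G'}
    (hf : Function.Surjective f) : Generates (fun j => f (X j)) := by
  have := congrArg (Subgroup.map f) hX
  rwa [MonoidHom.map_closure, ← Set.range_comp, Subgroup.map_top_of_surjective f hf] at this

/-- A homomorphism can be computed on words. -/
theorem Generates.exists_primrec {n n' : ℕ} (X : Fin n → G) {X' : Fin n' → G'}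
    (hX' : Generates X') (f : G →* G') :
    ∃ F : GWord n → GWord n', Primrec F ∧ ∀ w, GWord.eval X' (F w) = f (GWord.eval X w) := by
  -- A finite table of images of the letters; it is chosen, not computed, and substitution from it
  -- is primitive recursive.
  choose c hc using fun p : Fin n × Bool =>
    hX'.exists_eval (f (if p.2 then X p.1 else (X p.1)⁻¹))
  refine ⟨fun w => w.flatMap c, Primrec.list_flatMap Primrec.id
    ((Primrec.dom_finite c).comp Primrec.snd).to₂, fun w => ?_⟩
  induction w with
  | nil => simp [GWord.eval]
  | cons p w ih =>
    have h2 : GWord.eval X (p :: w) = GWord.eval X [p] * GWord.eval X w :=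
      GWord.eval_append X [p] w
    dsimp only at ih ⊢
    rw [List.flatMap_cons, GWord.eval_append, ih, hc, h2, map_mul]
    simp [GWord.eval]

theorem genBy_append {n : ℕ} (X : Fin n → G) (vs ws : List (GWord n)) :
    genBy X (vs ++ ws) = genBy X vs ⊔ genBy X ws := by
  rw [genBy, genBy, genBy, ← Subgroup.closure_union]
  congr 1
  ext g
  simp [or_and_right, exists_or]

theorem genBy_map {n n' : ℕ} {X : Fin n → G} {X' : Fin n' → G'} {f : G →* G'}
    {F : GWord n → GWord n'} (hF : ∀ w, GWord.eval X' (F w) = f (GWord.eval X w))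
    (ws : List (GWord n)) : genBy X' (ws.map F) = (genBy X ws).map f := by
  rw [genBy, genBy, MonoidHom.map_closure]
  congr 1
  ext g
  simp [hF]

theorem genBy_fg {n : ℕ} (X : Fin n → G) (ws : List (GWord n)) : (genBy X ws).FG := by
  refine (Subgroup.fg_iff _).2 ⟨_, rfl, ?_⟩
  exact ws.finite_toSet.image (GWord.eval X)

theorem Generates.exists_genBy {n : ℕ} {X : Fin n → G} (hX : Generates X) {H : Subgroup G}
    (hH : H.FG) : ∃ ws, genBy X ws = H := by
  obtain ⟨s, rfl⟩ := hH
  choose c hc using hX.exists_eval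
  refine ⟨s.toList.map c, ?_⟩
  rw [genBy]
  congr 1
  ext g
  simp [hc]

theorem Generates.fg {n : ℕ} {X : Fin n → G} (hX : Generates X) : Group.FG G :=
  Group.fg_iff.2 ⟨_, hX, Set.finite_range X⟩

end Words

/-! ### From partial to total algorithms -/

section Computability

/-- The partial algorithm halts on every value of `g`, so the composite is total and coincides with
the pointwise chosen `F`. -/
theorem exists_computable_of_partrec {α β γ : Type*} [Primcodable α] [Primcodable β]
    [Primcodable γ] {f : β →. γ} (hf : Partrec f) {g : α → β} (hg : Computable g)
    {p : α → γ → Prop} (h : ∀ a, ∃ c ∈ f (g a), p a c) :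
    ∃ F : α → γ, Computable F ∧ ∀ a, p a (F a) := by
  choose F hF hp using h
  exact ⟨F, (hf.comp hg).of_eq fun a => Part.eq_some_iff.2 (hF a), hp⟩

end Computability

/-! ### Cosets coded by words -/

section Representation

variable {α : Type} [Primcodable α] {G G' : Type u}

/-- A code `b` with `A a = r b` can be computed from `a`, unless `A a` is found to be empty. -/
def CodeComputable {β : Type} [Primcodable β] (r : β → Set G) (A : α → Set G) : Prop :=
  ∃ f : α → Option β, Computable f ∧ ∀ a, (f a = none → A a = ∅) ∧ ∀ b, f a = some b → A a = r b

theorem CodeComputable.comp {β γ : Type} [Primcodable β] [Primcodable γ] {r : β → Set G}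
    {r' : γ → Set G'} {A : α → Set G} {A' : α → Set G'} (hA : CodeComputable r A)
    (hempty : ∀ a, A a = ∅ → A' a = ∅) {F : β → γ} (hF : Primrec F)
    (h : ∀ a b, A a = r b → A' a = r' (F b)) : CodeComputable r' A' := by
  obtain ⟨f, hf, hfA⟩ := hA
  refine ⟨fun a => (f a).map F, Computable.option_map hf (hF.comp Primrec.snd).to_comp.to₂,
    fun a => ⟨fun hn => hempty a ((hfA a).1 (Option.map_eq_none_iff.1 hn)), fun c hc => ?_⟩⟩
  obtain ⟨b, hb, rfl⟩ := Option.map_eq_some_iff.1 hc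
  exact h a b ((hfA a).2 b hb)

variable [Group G] [Group G']

/-- The left coset `y M` given by generators of `M` and `y`. -/
def wordLeftCoset {t : ℕ} (Y : Fin t → G) (b : List (GWord t) × GWord t) : Set G :=
  (fun g => GWord.eval Y b.2 * g) '' (genBy Y b.1 : Set G)

/-- The right coset `L x` given by generators of `L` and `x`. -/
def wordRightCoset {t : ℕ} (Y : Fin t → G) (b : List (GWord t) × GWord t) : Set G :=
  (fun g => g * GWord.eval Y b.2) '' (genBy Y b.1 : Set G)

/-- The words `v w v⁻¹`, for `w` in a list. -/
def conjWords {t : ℕ} (v : GWord t) (ws : List (GWord t)) : List (GWord t) :=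
  ws.map fun w => v ++ w ++ GWord.inv v

theorem genBy_conjWords {t : ℕ} (Y : Fin t → G) (v : GWord t) (ws : List (GWord t)) :
    genBy Y (conjWords v ws) = (genBy Y ws).map (MulAut.conj (GWord.eval Y v)).toMonoidHom :=
  genBy_map (fun w => by simp [GWord.eval_append, GWord.eval_inv, mul_assoc]) ws

theorem primrec_conjWords {t : ℕ} : Primrec₂ (conjWords (t := t)) :=
  Primrec.list_map Primrec.snd (Primrec.list_append.comp
    (Primrec.list_append.comp (Primrec.fst.comp Primrec.fst) Primrec.snd)
    (GWord.primrec_inv.comp (Primrec.fst.comp Primrec.fst))).to₂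

theorem CodeComputable.change_generators {t : ℕ} {Y : Fin t → G} {A : α → Set G}
    (hA : CodeComputable (wordLeftCoset Y) A) {t' : ℕ} {Y' : Fin t' → G} (hY' : Generates Y') :
    CodeComputable (wordLeftCoset Y') A := by
  obtain ⟨T, hT, hT'⟩ := Generates.exists_primrec Y hY' (MonoidHom.id G)
  refine hA.comp (fun a h => h) (F := fun b => (b.1.map T, T b.2))
    (Primrec.pair (Primrec.list_map Primrec.fst (hT.comp Primrec.snd).to₂)
      (hT.comp Primrec.snd)) fun a b h => ?_
  rw [wordLeftCoset, genBy_map hT', hT', Subgroup.map_id]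
  exact h

theorem CodeComputable.toRightCoset {t : ℕ} {Y : Fin t → G} {A : α → Set G}
    (hA : CodeComputable (wordLeftCoset Y) A) : CodeComputable (wordRightCoset Y) A := by
  refine hA.comp (fun a h => h) (F := fun b => (conjWords b.2 b.1, b.2))
    (Primrec.pair (primrec_conjWords.comp Primrec.snd Primrec.fst) Primrec.snd) fun a b h => ?_
  rw [h, wordLeftCoset, wordRightCoset, genBy_conjWords, leftCoset_eq_rightCoset]

theorem CodeComputable.mul_inv_mul {t : ℕ} {Y : Fin t → G} (hY : Generates Y) {A : α → Set G}
    (hA : CodeComputable (wordLeftCoset Y) A) (a₀ b₀ : G) :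
    CodeComputable (wordRightCoset Y) fun a => {s | ∃ z ∈ A a, s = a₀⁻¹ * z⁻¹ * b₀} := by
  obtain ⟨v, hv⟩ := hY.exists_eval a₀⁻¹
  obtain ⟨w, hw⟩ := hY.exists_eval b₀
  refine hA.comp (fun a h => by simp [h])
    (F := fun b => (conjWords v b.1, v ++ GWord.inv b.2 ++ w))
    (Primrec.pair (primrec_conjWords.comp (Primrec.const v) Primrec.fst)
      (Primrec.list_append.comp (Primrec.list_append.comp (Primrec.const v)
        (GWord.primrec_inv.comp Primrec.snd)) (Primrec.const w))) fun a b h => ?_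
  rw [h, wordLeftCoset, wordRightCoset, genBy_conjWords, mul_leftCoset_inv_mul, GWord.eval_append, GWord.eval_append,
    GWord.eval_inv, hv, hw]

/-- `Lx = x(x⁻¹Lx)`: the base of the algorithmic induction. -/
theorem leftComputable_rightCoset {t : ℕ} (X : Fin t → G) :
    CodeComputable (wordLeftCoset X) fun a : List (GWord t) × GWord t =>
      (fun g => g * GWord.eval X a.2) '' (genBy X a.1 : Set G) := by
  refine ⟨fun a => some (conjWords (GWord.inv a.2) a.1, a.2), ?_,
    fun a => ⟨fun h => by simp at h, ?_⟩⟩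
  · exact (Primrec.option_some.comp (Primrec.pair (primrec_conjWords.comp
      (GWord.primrec_inv.comp Primrec.snd) Primrec.fst) Primrec.snd)).to_comp
  · intro b h
    obtain rfl := Option.some.inj h
    dsimp only
    rw [wordLeftCoset, genBy_conjWords, GWord.eval_inv, rightCoset_eq_leftCoset]

theorem prod_top_eq_sup (L : Subgroup G) : (L.prod ⊤ : Subgroup (G × G')) =
    L.map (MonoidHom.inl G G') ⊔ (⊤ : Subgroup G').map (MonoidHom.inr G G') := by
  apply le_antisymm
  · rintro ⟨g, h⟩ ⟨hg, -⟩
    have : (g, h) = MonoidHom.inl G G' g * MonoidHom.inr G G' h := by simp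
    rw [this]
    exact Subgroup.mul_mem_sup ⟨g, hg, rfl⟩ ⟨h, trivial, rfl⟩
  · refine sup_le ?_ ?_
    · rintro _ ⟨g, hg, rfl⟩
      exact ⟨hg, trivial⟩
    · rintro _ ⟨h, -, rfl⟩
      exact ⟨L.one_mem, trivial⟩

/-- Generators of `L × G'` can be computed from generators of `L`. -/
theorem exists_primrec_prod_top {s m : ℕ} (X : Fin s → G) {Z : Fin m → G × G'}
    (hZ : Generates Z) : ∃ F : List (GWord s) → List (GWord m), Primrec F ∧
      ∀ ws, genBy Z (F ws) = (genBy X ws).prod ⊤ := by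
  obtain ⟨T, hT, hT'⟩ := Generates.exists_primrec X hZ (MonoidHom.inl G G')
  -- Finite generation of `G'` comes from projecting the given generators of the product.
  have hfg : ((⊤ : Subgroup G').map (MonoidHom.inr G G')).FG := by
    have := hZ.fg
    have := (Group.fg_of_surjective (f := MonoidHom.snd G G') Prod.snd_surjective).out
    obtain ⟨s, hs, hs'⟩ := (Subgroup.fg_iff _).1 this
    exact (Subgroup.fg_iff _).2 ⟨_, by rw [← hs, MonoidHom.map_closure], hs'.image _⟩
  obtain ⟨vs, hvs⟩ := hZ.exists_genBy hfg
  refine ⟨fun ws => ws.map T ++ vs, Primrec.list_append.comp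
    (Primrec.list_map Primrec.id (hT.comp Primrec.snd).to₂) (Primrec.const vs), fun ws => ?_⟩
  rw [genBy_append, genBy_map hT', hvs, prod_top_eq_sup]

/-- The effective form of `transfer_eq_leftCoset`. The two hypotheses may use different generating
tuples, so words for the tall subgroup are produced over each of them. -/
theorem CodeComputable.transfer {s : ℕ} {X : Fin s → G} {A : α → Set G}
    (hA : CodeComputable (wordRightCoset X) A) {W : Subgroup (G × G'ᵐᵒᵖ)} (hW : EffRelHowson W (Tall G G'))
    (hW' : RelCosetIntersectionSolvable W (Tall G G')) (g : G × G'ᵐᵒᵖ) :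
    ∃ (t : ℕ) (Y : Fin t → G'), Generates Y ∧ CodeComputable (wordLeftCoset Y) fun a =>
      FreeIG.transfer ((fun w => w * g) '' (W : Set (G × G'ᵐᵒᵖ))) (A a) := by
  obtain ⟨f, hf, hfA⟩ := hA
  obtain ⟨-, m, Z, hZ, h, hh, hhW⟩ := hW
  obtain ⟨m', Z', hZ', c, hc, hcW⟩ := hW'
  obtain ⟨F, hF, hFZ⟩ := exists_primrec_prod_top X hZ
  obtain ⟨F', hF', hFZ'⟩ := exists_primrec_prod_top X hZ'
  obtain ⟨gw, hgw⟩ := hZ'.exists_eval g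
  obtain ⟨T, hT, hTZ⟩ := Generates.exists_primrec X hZ' (MonoidHom.inl G G'ᵐᵒᵖ)
  have htall : ∀ ws, (genBy X ws).prod ⊤ ∈ Tall G G' := fun ws => ⟨_, genBy_fg X ws, rfl⟩
  obtain ⟨h', hh', hh'W⟩ := exists_computable_of_partrec hh hF.to_comp
    (p := fun ws out => genBy Z out = W ⊓ (genBy X ws).prod ⊤) fun ws => by
      simpa only [hFZ] using hhW (F ws) (by rw [hFZ]; exact htall ws)
  obtain ⟨c', hc', hc'W⟩ := exists_computable_of_partrec hc
    (g := fun b : List (GWord s) × GWord s => (F' b.1, gw, T b.2))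
    (Primrec.pair (hF'.comp Primrec.fst)
      (Primrec.pair (Primrec.const gw) (hT.comp Primrec.snd))).to_comp
    (p := fun b out =>
      let S : Set (G × G'ᵐᵒᵖ) := (fun w => w * g) '' (W : Set (G × G'ᵐᵒᵖ)) ∩
        (fun k => k * (GWord.eval X b.2, 1)) ''
          (((genBy X b.1).prod ⊤ : Subgroup (G × G'ᵐᵒᵖ)) : Set (G × G'ᵐᵒᵖ))
      (out = none ↔ S = ∅) ∧ ∀ z, out = some z → GWord.eval Z' z ∈ S) fun b => by
      have := hcW (F' b.1) gw (T b.2) (by rw [hFZ']; exact htall _)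
      rw [hFZ', hTZ, hgw] at this
      exact this
  -- The output is written over the images of the Howson generators; `T₁` and `T₂` translate into
  -- them from both tuples.
  have hY : Generates fun j => sndInv G G' (Z j) :=
    hZ.map_surjective fun t => ⟨(1, MulOpposite.op t⁻¹), by simp⟩
  refine ⟨m, _, hY, ?_⟩
  obtain ⟨T₁, hT₁, hTZ₁⟩ := Generates.exists_primrec Z hY (sndInv G G')
  obtain ⟨T₂, hT₂, hTZ₂⟩ := Generates.exists_primrec Z' hY (sndInv G G')
  -- The word for `sndInv z` is inverted because the coset representative is `(sndInv z)⁻¹`.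
  refine ⟨fun a => (f a).bind fun b => (c' b).map fun z =>
    ((h' b.1).map T₁, GWord.inv (T₂ z)), ?_, fun a => ⟨fun hn => ?_, fun ms hs => ?_⟩⟩
  · have hout : Computable fun d : (α × (List (GWord s) × GWord s)) × GWord m' =>
        ((h' d.1.2.1).map T₁, GWord.inv (T₂ d.2)) :=
      Computable.pair
        ((Primrec.list_map Primrec.id (hT₁.comp Primrec.snd).to₂).to_comp.comp
          (hh'.comp (Computable.fst.comp (Computable.snd.comp Computable.fst))))
        ((GWord.primrec_inv.comp hT₂).to_comp.comp Computable.snd)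
    exact Computable.option_bind hf
      (Computable.option_map (hc'.comp Computable.snd) hout.to₂).to₂
  · cases hfa : f a with
    | none =>
      dsimp only
      rw [(hfA a).1 hfa, transfer_empty]
    | some b =>
      dsimp only at hn ⊢
      rw [hfa, Option.bind_some, Option.map_eq_none_iff] at hn
      rw [(hfA a).2 _ hfa]
      exact transfer_eq_empty ((hc'W b).1.1 hn)
  · obtain ⟨b, hfa, hb⟩ := Option.bind_eq_some_iff.1 hs
    obtain ⟨z, hz, hzb⟩ := Option.map_eq_some_iff.1 hb
    subst hzb
    obtain ⟨hz1, hz2⟩ := (hc'W b).2 z hz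
    dsimp only
    rw [(hfA a).2 _ hfa, wordRightCoset, wordLeftCoset, transfer_eq_leftCoset hz1 hz2, genBy_map hTZ₁, hh'W, GWord.eval_inv,
      hTZ₂]

end Representation

/-! ### The algorithm along `θ`: part 3 -/

section Theta

variable {E : Type u} {B : BiorderedSet E} {n : ℕ} {D : Fin (n + 1) → Set (IG B)}
  {C : ∀ k, ReesCoord B (D k)} {x y : IG B} (P : Decomposition C x) (Q : Decomposition C y)

theorem thetaSeq_leftComputable (hW : ∀ k : Fin n,
      EffRelHowson (P.W k) (Tall (C k.castSucc).G (C k.succ).G) ∧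
      RelCosetIntersectionSolvable (P.W k) (Tall (C k.castSucc).G (C k.succ).G))
    {s : ℕ} {X : Fin s → (C 0).G} (hX : Generates X) (k : Fin (n + 1)) :
    ∃ (t : ℕ) (Y : Fin t → (C k).G), Generates Y ∧
      CodeComputable (wordLeftCoset Y) fun a : List (GWord s) × GWord s =>
        thetaSeq P Q ((fun g => g * GWord.eval X a.2) '' (genBy X a.1 : Set (C 0).G)) k := by
  induction k using Fin.induction with
  | zero => exact ⟨s, X, hX, leftComputable_rightCoset X⟩
  | succ k ih =>
    obtain ⟨t, Y, hY, hA⟩ := ih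
    have hprep : CodeComputable (wordRightCoset Y) fun a : List (GWord s) × GWord s => thetaPrep P Q k
        (thetaSeq P Q ((fun g => g * GWord.eval X a.2) '' (genBy X a.1 : Set (C 0).G))
          k.castSucc) := by
      unfold thetaPrep
      split_ifs
      · exact hA.toRightCoset
      · exact hA.mul_inv_mul hY _ _
    simp only [thetaSeq_succ]
    -- Whether a connecting walk exists is a fixed fact, independent of the input, so this case
    -- distinction need not be computable.
    obtain ⟨g, hg⟩ | h : (∃ g, walkCoset (C k.castSucc) (C k.succ)
        (P.l k.castSucc, P.i k.succ) (Q.l k.castSucc, Q.i k.succ) =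
          (fun w => w * g) '' (P.W k : Set ((C k.castSucc).G × (C k.succ).Gᵐᵒᵖ))) ∨ _ :=
      (walkCoset_eq_empty_or _ _ _ _).symm
    · rw [hg]
      exact hprep.transfer (hW k).1 (hW k).2 g
    -- Without a walk the algorithm always answers `none`; the hypothesis is used only to supply
    -- some generating tuple.
    · obtain ⟨-, m, Z, hZ, -⟩ := (hW k).1
      refine ⟨m, _, hZ.map_surjective (f := sndInv _ _) fun t =>
        ⟨(1, MulOpposite.op t⁻¹), by simp⟩, fun _ => none, Computable.const none, fun a =>
          ⟨fun _ => by simp only [h, empty_transfer], fun _ h => by simp at h⟩⟩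

end Theta

end FreeIG

/-! ### The three statements -/

theorem mainTheorem7 {E : Type u} [Finite E] (B : FreeIG.BiorderedSet E) {n : ℕ}
    {D : Fin (n + 1) → Set (FreeIG.IG B)} (C : ∀ k, FreeIG.ReesCoord B (D k))
    (u v : FreeIG.IG B) (P : FreeIG.Decomposition C u) (Q : FreeIG.Decomposition C v) :
    (∀ (L : Subgroup (C 0).G) (x : (C 0).G),
      FreeIG.theta P Q ((fun g => g * x) '' (L : Set (C 0).G)) = ∅ ∨
        ∃ (M : Subgroup (C (Fin.last n)).G) (y : (C (Fin.last n)).G),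
          FreeIG.theta P Q ((fun g => g * x) '' (L : Set (C 0).G)) =
            (fun g => y * g) '' (M : Set (C (Fin.last n)).G)) ∧
    ((∀ k : Fin n, FreeIG.RelHowson (P.W k) (FreeIG.Tall (C k.castSucc).G (C k.succ).G)) →
      ∀ (L : Subgroup (C 0).G) (x : (C 0).G), L.FG →
        ∀ (M : Subgroup (C (Fin.last n)).G) (y : (C (Fin.last n)).G),
          FreeIG.theta P Q ((fun g => g * x) '' (L : Set (C 0).G)) =
            (fun g => y * g) '' (M : Set (C (Fin.last n)).G) → M.FG) ∧
    ((∀ k : Fin n,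
        FreeIG.EffRelHowson (P.W k) (FreeIG.Tall (C k.castSucc).G (C k.succ).G) ∧
        FreeIG.RelCosetIntersectionSolvable (P.W k)
          (FreeIG.Tall (C k.castSucc).G (C k.succ).G)) →
      ∀ (s : ℕ) (X : Fin s → (C 0).G), FreeIG.Generates X →
      ∀ (t : ℕ) (Y : Fin t → (C (Fin.last n)).G), FreeIG.Generates Y →
        ∃ f : List (FreeIG.GWord s) × FreeIG.GWord s →
            Option (List (FreeIG.GWord t) × FreeIG.GWord t),
          Computable f ∧ ∀ (ws : List (FreeIG.GWord s)) (x : FreeIG.GWord s),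
            (f (ws, x) = none ↔ FreeIG.theta P Q ((fun g => g * FreeIG.GWord.eval X x) ''
              (FreeIG.genBy X ws : Set (C 0).G)) = ∅) ∧
            ∀ ms y, f (ws, x) = some (ms, y) →
              FreeIG.theta P Q ((fun g => g * FreeIG.GWord.eval X x) ''
                (FreeIG.genBy X ws : Set (C 0).G)) =
              (fun g => FreeIG.GWord.eval Y y * g) ''
                (FreeIG.genBy Y ms : Set (C (Fin.last n)).G)) := by
  refine ⟨fun L x => ?_, fun hH L x hL M y hM => ?_, fun hW s X hX t Y hY => ?_⟩
  · exact (FreeIG.thetaSeq_eq_empty_or_leftCoset P Q L x (Fin.last n)).imp_right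
      fun ⟨M, y, h, _⟩ => ⟨M, y, h⟩
  · rcases FreeIG.thetaSeq_eq_empty_or_leftCoset P Q L x (Fin.last n) with h | ⟨M', y', h, hfg⟩
    · have hne := (FreeIG.mem_leftCoset (H := M) (y := y) (s := y)).2
        (by rw [inv_mul_cancel]; exact M.one_mem)
      rw [← hM, show FreeIG.theta P Q _ = ∅ from h] at hne
      exact hne.elim
    · rw [FreeIG.subgroup_eq_of_leftCoset_eq (hM.symm.trans h)]
      exact hfg hH hL
  · obtain ⟨t', Y', -, hA⟩ := FreeIG.thetaSeq_leftComputable P Q hW hX (Fin.last n)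
    obtain ⟨f, hf, hfA⟩ := hA.change_generators hY
    refine ⟨f, hf, fun ws x => ⟨⟨(hfA (ws, x)).1, fun h => ?_⟩, fun ms y => (hfA (ws, x)).2 (ms, y)⟩⟩
    -- `CodeComputable` only makes `none` imply emptiness; the converse holds because a returned
    -- code denotes a coset, which contains its representative.
    by_contra hne
    obtain ⟨⟨ms, y⟩, hy⟩ := Option.ne_none_iff_exists'.1 hne
    have hmem := (FreeIG.mem_leftCoset (H := FreeIG.genBy Y ms) (y := FreeIG.GWord.eval Y y)
      (s := FreeIG.GWord.eval Y y)).2 (by rw [inv_mul_cancel]; exact Subgroup.one_mem _)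
    exact (h.subset (((hfA (ws, x)).2 (ms, y) hy).symm.subset hmem)).elim
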